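/- Let $\mathbf C$ and $\mathbf D$ be varieties of algebras of types $\Omega_{\mathbf C}$ and $\Omega_{\mathbf D}$ (each given by a small set of operations, of possibly infinite small arities, and a set of identities). An $\Omega_{\mathbf D}$-coalgebra in $\mathbf C$ is an object $|R|$ of $\mathbf C$ with, for each $\alpha\in\Omega_{\mathbf D}$, a morphism (co-operation) $\alpha^R:|R|\to\coprod_{\mathrm{ari}(\alpha)}|R|$; it makes every hom-set $\mathbf C(|R|,B)$ an $\Omega_{\mathbf D}$-algebra $\mathbf C(R,B)$, and $R$ is a $\mathbf D$-coalgebra if all these algebras lie in $\mathbf D$. A morphism of coalgebras $R\to S$ is a morphism $|R|\to|S|$ making commuting squares with the co-operations; $\mathrm{Coalg}(\mathbf C,\mathbf D)$ is the category of $\mathbf D$-coalgebras in $\mathbf C$. $\mathrm{Rep}(\mathbf C,\mathbf D)$ is the full subcategory of the category of functors $\mathbf C\to\mathbf D$ consisting of those $F$ such that $U_{\mathbf D}\circ F$ is representable, where $U_{\mathbf D}:\mathbf D\to\mathbf{Set}$ is the underlying set functor; $\mathrm{Rep}(\mathbf C,\mathbf{Set})$ is the category of representable set-valued functors on $\mathbf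 C$. Theorem. For every object $A$ of $\mathbf C$ there is a universal $\mathbf D$-coalgebra $R$ in $\mathbf C$ with a homomorphism $f:|R|\to A$: for every $\mathbf D$-coalgebra $Q$ and homomorphism $g:|Q|\to A$ there is a unique morphism of coalgebras $h:Q\to R$ with $f\circ h=g$. In other words, the forgetful functor $\mathrm{Coalg}(\mathbf C,\mathbf D)\to\mathbf C$ has a right adjoint; equivalently, the functor $\mathrm{Rep}(\mathbf C,\mathbf D)\to\mathrm{Rep}(\mathbf C,\mathbf{Set})$ given by composition with $U_{\mathbf D}$ has a left adjoint. More generally, let $\mathbf D'$ be a variety whose operation symbols form a subset of those of $\mathbf D$, with the same arities (no assumption is made on the identities of $\mathbf D'$). Then for every $\mathbf D'$-coalgebra $R'$ in $\mathbf C$ there is a universal $\mathbf D$-coalgebra $R$ in $\mathbf C$ with a homomorphism $f:|R|\to|R'|$ respecting the co-operations of $\mathbf D'$ (that is, making commuting squares with $\alpha^R$ and $\alpha^{R'}$ for every operation symbol $\alpha$ of $\mathbf D'$): for every $\mathbf D$-coalgebra $Q$ and homomorphism $g:|Q|\to|R'|$ respecting those co-operations there is a unique morphism of coalgebras $h:Q\to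 R$ with $f\circ h=g$. -/

import Mathlib

open CategoryTheory CategoryTheory.Limits

universe u v

namespace GenAlg

/-- A type of algebras: a small set of operation symbols, each with a (possibly infinite) small
set of argument places. -/
structure Signature where
  /-- the operation symbols -/
  Op : Type u
  /-- the set indexing the arguments of an operation symbol -/
  arity : Op → Type u

/-- The subtype of `Ω` whose operation symbols are those in `s`, with the same arities. -/
def Signature.restrict (Ω : Signature.{u}) (s : Set Ω.Op) : Signature.{u} where
  Op := s
  arity α := Ω.arity α.1

/-- Terms of type `Ω` in the variables `κ`, i.e. the elements of the free `Ω`-algebra on `κ`. -/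
inductive Term (Ω : Signature.{u}) (κ : Type u) : Type u
  | var (x : κ) : Term Ω κ
  | op (α : Ω.Op) (t : Ω.arity α → Term Ω κ) : Term Ω κ

/-- An `Ω`-algebra. -/
structure OpAlg (Ω : Signature.{u}) where
  carrier : Type u
  op : ∀ α : Ω.Op, (Ω.arity α → carrier) → carrier

/-- The value of a term at a tuple `x` of elements of an algebra, i.e. the image of the term under
the homomorphism from the term algebra that extends `x`. -/
def Term.eval {Ω : Signature.{u}} (A : OpAlg Ω) {κ : Type u} (x : κ → A.carrier) :
    Term Ω κ → A.carrier
  | .var i => x i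
  | .op α t => A.op α fun j => (t j).eval A x

/-- A variety of algebras of type `Ω`, given by a small set of defining identities `lhs = rhs`,
each in its own small set of variables. -/
structure Variety (Ω : Signature.{u}) where
  Idn : Type u
  vars : Idn → Type u
  lhs : ∀ i, Term Ω (vars i)
  rhs : ∀ i, Term Ω (vars i)

variable {Ω : Signature.{u}}

/-- `A` satisfies all defining identities of `V`. -/
def Variety.Models (V : Variety Ω) (A : OpAlg Ω) : Prop :=
  ∀ (i : V.Idn) (x : V.vars i → A.carrier), (V.lhs i).eval A x = (V.rhs i).eval A x

/-- An algebra of the variety `V`. -/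
structure Variety.Alg (V : Variety Ω) extends OpAlg Ω where
  models : V.Models toOpAlg

/-- Homomorphisms of `Ω`-algebras. -/
@[ext]
structure OpAlg.Hom (A B : OpAlg Ω) where
  toFun : A.carrier → B.carrier
  map_op : ∀ (α : Ω.Op) (a : Ω.arity α → A.carrier),
    toFun (A.op α a) = B.op α fun j => toFun (a j)

namespace Variety

variable (V : Variety Ω)

/-- The variety `V` as a category: the morphisms are all homomorphisms. -/
instance : Category.{u} V.Alg where
  Hom A B := OpAlg.Hom A.toOpAlg B.toOpAlg
  id _ := ⟨fun a => a, fun _ _ => rfl⟩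
  comp f g := ⟨fun a => g.toFun (f.toFun a), fun α a => by rw [f.map_op, g.map_op]⟩

/-- The underlying set functor of a variety. -/
def forget : V.Alg ⥤ Type u where
  obj A := A.carrier
  map f := ↾(OpAlg.Hom.toFun f)

end Variety

/-! ### Coproducts in a variety -/

/-- Substitution of terms for the variables of a term. -/
def Term.subst {κ κ' : Type u} (x : κ → Term Ω κ') : Term Ω κ → Term Ω κ'
  | .var i => x i
  | .op α t => .op α fun j => (t j).subst x

theorem Term.eval_subst (A : OpAlg Ω) {κ κ' : Type u} (x : κ → Term Ω κ') (y : κ' → A.carrier)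
    (t : Term Ω κ) : (t.subst x).eval A y = t.eval A fun i => (x i).eval A y := by
  induction t with
  | var i => rfl
  | op α t ih => simp only [Term.subst, Term.eval, ih]

theorem Term.map_eval {A B : OpAlg Ω} (f : OpAlg.Hom A B) {κ : Type u} (x : κ → A.carrier)
    (t : Term Ω κ) : f.toFun (t.eval A x) = t.eval B fun i => f.toFun (x i) := by
  induction t with
  | var i => rfl
  | op α t ih => simp only [Term.eval, f.map_op, ih]

namespace Variety

variable (V : Variety Ω) {ι : Type u} (A : ι → V.Alg)

/-- The congruence that presents the coproduct of the algebras `A i` on the disjoint union of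
their underlying sets. -/
inductive CoprodRel : Term Ω (Σ i, (A i).carrier) → Term Ω (Σ i, (A i).carrier) → Prop
  | refl (s) : CoprodRel s s
  | symm {s t} : CoprodRel s t → CoprodRel t s
  | trans {s t r} : CoprodRel s t → CoprodRel t r → CoprodRel s r
  | congr (α : Ω.Op) {s t : Ω.arity α → Term Ω (Σ i, (A i).carrier)} :
      (∀ j, CoprodRel (s j) (t j)) → CoprodRel (.op α s) (.op α t)
  | table (i : ι) (α : Ω.Op) (a : Ω.arity α → (A i).carrier) :
      CoprodRel (.op α fun j => .var ⟨i, a j⟩) (.var ⟨i, (A i).op α a⟩)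
  | ident (e : V.Idn) (x : V.vars e → Term Ω (Σ i, (A i).carrier)) :
      CoprodRel ((V.lhs e).subst x) ((V.rhs e).subst x)

/-- `CoprodRel` as an equivalence relation. -/
def coprodSetoid : Setoid (Term Ω (Σ i, (A i).carrier)) where
  r := V.CoprodRel A
  iseqv := ⟨CoprodRel.refl, CoprodRel.symm, CoprodRel.trans⟩

/-- The underlying `Ω`-algebra of the coproduct. -/
noncomputable def coprodOpAlg : OpAlg Ω where
  carrier := Quotient (V.coprodSetoid A)
  op α q := Quotient.mk _ (.op α fun j => (q j).out)

theorem coprodOpAlg_op_mk (α : Ω.Op) (t : Ω.arity α → Term Ω (Σ i, (A i).carrier)) :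
    (V.coprodOpAlg A).op α (fun j => Quotient.mk (V.coprodSetoid A) (t j)) =
      Quotient.mk (V.coprodSetoid A) (.op α t) :=
  Quotient.sound (CoprodRel.congr α fun j => Quotient.mk_out (s := V.coprodSetoid A) (t j))

theorem coprodOpAlg_eval_mk {κ : Type u} (x : κ → Term Ω (Σ i, (A i).carrier)) (t : Term Ω κ) :
    t.eval (V.coprodOpAlg A) (fun i => Quotient.mk (V.coprodSetoid A) (x i)) =
      Quotient.mk (V.coprodSetoid A) (t.subst x) := by
  induction t with
  | var i => rfl
  | op α t ih =>
    simp only [Term.eval, ih]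
    exact V.coprodOpAlg_op_mk A α _

/-- The coproduct of the algebras `A i` in `V`. -/
noncomputable def coprod : V.Alg where
  toOpAlg := V.coprodOpAlg A
  models e x := by
    have hx : x = fun i => Quotient.mk (V.coprodSetoid A) (x i).out :=
      funext fun i => (Quotient.out_eq (x i)).symm
    rw [hx, coprodOpAlg_eval_mk, coprodOpAlg_eval_mk]
    exact Quotient.sound (CoprodRel.ident e _)

/-- The coprojections. -/
noncomputable def coprodInj (i : ι) : A i ⟶ V.coprod A where
  toFun a := Quotient.mk (V.coprodSetoid A) (.var ⟨i, a⟩)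
  map_op α a := ((V.coprodOpAlg_op_mk A α _).trans
    (Quotient.sound (CoprodRel.table i α a))).symm

theorem CoprodRel.eval_eq {V : Variety Ω} {A : ι → V.Alg} {B : V.Alg} (f : ∀ i, A i ⟶ B)
    {s t : Term Ω (Σ i, (A i).carrier)} (h : V.CoprodRel A s t) :
    s.eval B.toOpAlg (fun p => (f p.1).toFun p.2) =
      t.eval B.toOpAlg (fun p => (f p.1).toFun p.2) := by
  induction h with
  | refl s => rfl
  | symm _ ih => exact ih.symm
  | trans _ _ ih₁ ih₂ => exact ih₁.trans ih₂
  | congr α _ ih => simp only [Term.eval, ih]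
  | table i α a => exact ((f i).map_op α a).symm
  | ident e x => rw [Term.eval_subst, Term.eval_subst]; exact B.models e _

/-- The homomorphism from the coproduct induced by a family of homomorphisms. -/
noncomputable def coprodDesc {B : V.Alg} (f : ∀ i, A i ⟶ B) : V.coprod A ⟶ B where
  toFun := Quotient.lift (s := V.coprodSetoid A)
    (fun t => t.eval B.toOpAlg fun p => (f p.1).toFun p.2) fun _ _ h => h.eval_eq f
  map_op α q := by
    have hq : q = fun i => Quotient.mk (V.coprodSetoid A) (q i).out :=
      funext fun i => (Quotient.out_eq (q i)).symm
    rw [hq]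
    exact congrArg _ (V.coprodOpAlg_op_mk A α _)

/-- The algebra `coprod` is a coproduct. -/
noncomputable def coprodIsColimit : IsColimit (Cofan.mk (V.coprod A) (V.coprodInj A)) :=
  Cofan.IsColimit.mk _ (fun s => V.coprodDesc A s.inj) (fun s i => rfl) fun s m hm => by
    apply OpAlg.Hom.ext
    funext q
    induction q using Quotient.inductionOn with
    | h t =>
      induction t with
      | var p => exact congrFun (congrArg OpAlg.Hom.toFun (hm p.1)) p.2
      | op α t ih =>
        rw [← coprodOpAlg_op_mk]
        exact (OpAlg.Hom.map_op m α _).trans ((congrArg _ (funext ih)).trans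
          (OpAlg.Hom.map_op (V.coprodDesc A s.inj) α _).symm)

instance : HasCoproducts.{u} V.Alg :=
  hasCoproducts_of_colimit_cofans (fun A => Cofan.mk (V.coprod A) (V.coprodInj A))
    fun A => V.coprodIsColimit A

end Variety

/-! ### Coalgebras in a category with coproducts -/

/-- An `Ω`-coalgebra in `A`: an object with, for each operation symbol `α`, a co-operation from it
to its `arity α`-fold copower. -/
structure OpCoalg (Ω : Signature.{u}) (A : Type v) [Category.{u} A] [HasCoproducts.{u} A] where
  obj : A
  coop : ∀ α : Ω.Op, obj ⟶ ∐ fun _ : Ω.arity α => obj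

section

variable {A : Type v} [Category.{u} A] [HasCoproducts.{u} A]

/-- The `Ω`-algebra structure on the hom-set `A(|R|, B)` induced by an `Ω`-coalgebra `R`. -/
noncomputable def OpCoalg.homAlg (R : OpCoalg Ω A) (B : A) : OpAlg Ω where
  carrier := R.obj ⟶ B
  op α f := R.coop α ≫ Limits.Sigma.desc f

/-- Morphisms of `Ω`-coalgebras: morphisms of underlying objects that make commuting squares with
the co-operations. -/
@[ext]
structure OpCoalg.Hom (R S : OpCoalg Ω A) where
  hom : R.obj ⟶ S.obj
  comm : ∀ α : Ω.Op, R.coop α ≫ Limits.Sigma.map (fun _ => hom) = hom ≫ S.coop α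

end

/-- A `V`-coalgebra in `A`: an `Ω`-coalgebra `R` that cosatisfies the identities of `V`, i.e. such
that every induced algebra `A(R, B)` lies in `V`. -/
structure Coalg (A : Type v) [Category.{u} A] [HasCoproducts.{u} A] (V : Variety Ω)
    extends OpCoalg Ω A where
  cosat : ∀ B : A, V.Models (toOpCoalg.homAlg B)

section

variable (A : Type v) [Category.{u} A] [HasCoproducts.{u} A] (V : Variety Ω)

/-- The category `Coalg(A, V)` of `V`-coalgebras in `A`. -/
noncomputable instance : Category.{u} (Coalg A V) where
  Hom R S := OpCoalg.Hom R.toOpCoalg S.toOpCoalg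
  id R := ⟨𝟙 R.obj, fun α => by simp⟩
  comp f g := ⟨f.hom ≫ g.hom, fun α => by
    have h : Limits.Sigma.map (fun _ : Ω.arity α => f.hom ≫ g.hom) =
        Limits.Sigma.map (fun _ => f.hom) ≫ Limits.Sigma.map (fun _ => g.hom) := by
      ext; simp
    rw [h, ← Category.assoc, f.comm, Category.assoc, g.comm, Category.assoc]⟩
  id_comp f := OpCoalg.Hom.ext (Category.id_comp f.hom)
  comp_id f := OpCoalg.Hom.ext (Category.comp_id f.hom)
  assoc f g h := OpCoalg.Hom.ext (Category.assoc f.hom g.hom h.hom)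

variable {A V} in
/-- The morphism of underlying objects of a morphism of coalgebras. -/
def Coalg.base {R S : Coalg A V} (f : R ⟶ S) : R.obj ⟶ S.obj :=
  OpCoalg.Hom.hom f

/-- The forgetful functor `Coalg(A, V) ⥤ A`. -/
noncomputable def Coalg.forget : Coalg A V ⥤ A where
  obj R := R.obj
  map f := Coalg.base f

variable {A V} in
/-- For a `V`-coalgebra `R` and a `V'`-coalgebra `R'`, where `V'` is a variety whose type is a
subtype of that of `V`: the morphism `f : |R| ⟶ |R'|` respects the co-operations of `V'`. -/
def Coalg.Respects {s : Set Ω.Op} {V' : Variety (Ω.restrict s)} (R : Coalg A V) (R' : Coalg A V')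
    (f : R.obj ⟶ R'.obj) : Prop :=
  ∀ α : s, R.coop α.1 ≫ Limits.Sigma.map (fun _ : Ω.arity α.1 => f) = f ≫ R'.coop α

end

/-! ### Representable functors -/

section

variable (A : Type v) [Category.{u} A] (V : Variety Ω)

/-- The category `Rep(A, Set)` of representable set-valued functors on `A`, a full subcategory of
the category of all functors. -/
abbrev RepSet := ObjectProperty.FullSubcategory fun F : A ⥤ Type u => F.IsCorepresentable

/-- The category `Rep(A, V)` of representable `V`-valued functors on `A`: the functors whose
composite with the underlying set functor of `V` is representable, as a full subcategory of the
category of all functors. -/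
abbrev Rep := ObjectProperty.FullSubcategory fun F : A ⥤ V.Alg =>
  (F ⋙ V.forget).IsCorepresentable

/-- The functor `Rep(A, V) ⥤ Rep(A, Set)` given by composition with the underlying set functor. -/
def Rep.compForget : Rep A V ⥤ RepSet A :=
  ObjectProperty.lift _ (ObjectProperty.ι _ ⋙ (Functor.whiskeringRight A V.Alg (Type u)).obj V.forget)
    fun F => F.property

end

end GenAlg

open GenAlg

universe w w'

namespace GenAlg

/-! ### Terms, cosatisfaction of identities, and transport of coalgebras. -/

section CoalgebrasInCategory

variable {Ω : Signature.{u}} {A : Type v} [Category.{u} A] [HasCoproducts.{u} A]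

/-! The universal coalgebra over `R'` is a terminal object of the category of `D`-coalgebras over
`R'`, obtained by a solution-set argument. That category is cocomplete: colimits of coalgebras are
computed on underlying objects (`Coalg.hasColimitsOfShape`), since identities pass along jointly
epimorphic families (`OpCoalg.models_of_jointly_epi`). A weakly terminal object of a cocomplete
category yields a terminal one (`hasTerminal_of_weaklyTerminal`), so a bound on the coalgebras that
matter suffices.

The bound says that every coalgebra `Q` is a union of subcoalgebras of bounded size. The difficulty
is that a subalgebra `S` of `Q` need not have copowers embedding in those of `Q`, so a co-operation
may fail to restrict to `S` and identities may fail to be inherited. But each equality in a copower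
of `Q` has a derivation involving boundedly many elements of `Q`
(`Variety.CoprodRel.exists_witnesses`). Choosing such witnesses, and the elements occurring in
values of co-operations, as extra operations makes every nonempty closed subset a subcoalgebra: the
copowers indexed by arities and by variables of identities then embed
(`Coalg.ClosedSubset.coprodRel_of_map`). Closed subsets generated by few elements are quotients of
one set of terms, hence form an essentially small class (`essentiallySmall_boundedCoalg`).

The colimit of all bounded coalgebras over `R'` is weakly terminal, because its coprojections at the
generated subcoalgebras of `Q` glue to a morphism from `Q` (`Coalg.ClosedSubset.exists_glue`). The
statement on an algebra `A` is the case of no prescribed co-operations, and the one on representable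
functors follows by the Yoneda lemma. -/

theorem map_comp_map_of_eq {ι : Type u} {X Y Z : A} {f : X ⟶ Y} {g : Y ⟶ Z} {h : X ⟶ Z}
    (e : f ≫ g = h) :
    Limits.Sigma.map (fun _ : ι => f) ≫ Limits.Sigma.map (fun _ : ι => g) =
      Limits.Sigma.map (fun _ : ι => h) := by
  subst e
  exact Sigma.map_comp_map _ _

theorem sigma_map_id {ι : Type u} (X : A) :
    Limits.Sigma.map (fun _ : ι => 𝟙 X) = 𝟙 (∐ fun _ : ι => X) :=
  Limits.Sigma.hom_ext _ _ fun j => by simp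

/-- A factorization of a morphism of coalgebras through one that induces monomorphisms of copowers
is a morphism of coalgebras. -/
theorem OpCoalg.Hom.comm_of_comp_eq {R S T : OpCoalg Ω A} (i : OpCoalg.Hom S T)
    (k : OpCoalg.Hom R T) {f : R.obj ⟶ S.obj} (e : f ≫ i.hom = k.hom) (α : Ω.Op)
    [Mono (Limits.Sigma.map fun _ : Ω.arity α => i.hom)] :
    R.coop α ≫ Limits.Sigma.map (fun _ => f) = f ≫ S.coop α := by
  rw [← cancel_mono (Limits.Sigma.map fun _ : Ω.arity α => i.hom), Category.assoc,
    Category.assoc, map_comp_map_of_eq e, k.comm, i.comm, ← Category.assoc, e]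

/-- The value of a term at a tuple of morphisms in the algebra induced by a coalgebra. -/
noncomputable def OpCoalg.evalHom (R : OpCoalg Ω A) {B : A} {κ : Type u} (x : κ → (R.obj ⟶ B))
    (t : Term Ω κ) : R.obj ⟶ B :=
  t.eval (R.homAlg B) x

@[simp]
theorem OpCoalg.evalHom_op (R : OpCoalg Ω A) {B : A} {κ : Type u} (x : κ → (R.obj ⟶ B))
    (α : Ω.Op) (t : Ω.arity α → Term Ω κ) :
    R.evalHom x (.op α t) = R.coop α ≫ Limits.Sigma.desc fun j => R.evalHom x (t j) := rfl

theorem OpCoalg.models_homAlg_iff (V : Variety Ω) (R : OpCoalg Ω A) (B : A) :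
    V.Models (R.homAlg B) ↔ ∀ (e : V.Idn) (x : V.vars e → (R.obj ⟶ B)),
      R.evalHom x (V.lhs e) = R.evalHom x (V.rhs e) := Iff.rfl

theorem OpCoalg.evalHom_comp (R : OpCoalg Ω A) {B B' : A} (g : B ⟶ B') {κ : Type u}
    (x : κ → (R.obj ⟶ B)) (t : Term Ω κ) :
    R.evalHom x t ≫ g = R.evalHom (fun i => x i ≫ g) t := by
  induction t with
  | var i => rfl
  | op α t ih =>
    rw [evalHom_op, evalHom_op, Category.assoc]
    congr 1
    exact Limits.Sigma.hom_ext _ _ fun j => by simp [ih]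

theorem OpCoalg.Hom.comp_evalHom {R S : OpCoalg Ω A} (h : OpCoalg.Hom R S) {B : A} {κ : Type u}
    (x : κ → (S.obj ⟶ B)) (t : Term Ω κ) :
    h.hom ≫ S.evalHom x t = R.evalHom (fun i => h.hom ≫ x i) t := by
  induction t with
  | var i => rfl
  | op α t ih =>
    rw [evalHom_op, evalHom_op, ← Category.assoc, ← h.comm, Category.assoc]
    congr 1
    exact Limits.Sigma.hom_ext _ _ fun j => by simp [ih]

/-- A coalgebra with a jointly epimorphic family of morphisms from `V`-coalgebras is a
`V`-coalgebra. -/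
theorem OpCoalg.models_of_jointly_epi {V : Variety Ω} {R : OpCoalg Ω A} {J : Type*}
    {S : J → OpCoalg Ω A} (hS : ∀ j B, V.Models ((S j).homAlg B))
    (f : ∀ j, OpCoalg.Hom (S j) R)
    (hf : ∀ {B : A} (a b : R.obj ⟶ B), (∀ j, (f j).hom ≫ a = (f j).hom ≫ b) → a = b) (B : A) :
    V.Models (R.homAlg B) := by
  rw [models_homAlg_iff]
  intro e x
  refine hf _ _ fun j => ?_
  rw [Hom.comp_evalHom, Hom.comp_evalHom]
  exact (models_homAlg_iff V _ B).1 (hS j B) e _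

/-- A coalgebra with a morphism to a `V`-coalgebra which induces monomorphisms on the copowers
indexed by the variables of the identities is a `V`-coalgebra. -/
theorem OpCoalg.Hom.models_of_mono {V : Variety Ω} {R S : OpCoalg Ω A} (h : OpCoalg.Hom R S)
    (hS : ∀ B, V.Models (S.homAlg B))
    (hm : ∀ e : V.Idn, Mono (Limits.Sigma.map fun _ : V.vars e => h.hom)) (B : A) :
    V.Models (R.homAlg B) := by
  rw [models_homAlg_iff]
  intro e x
  have := hm e
  -- The coprojections form the generic tuple of morphisms: every other tuple is its composite with
  -- a morphism out of the copower. So the identity need only be checked here, where the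
  -- monomorphism transfers it from `S`.
  have generic : R.evalHom (Limits.Sigma.ι fun _ : V.vars e => R.obj) (V.lhs e) =
      R.evalHom (Limits.Sigma.ι fun _ : V.vars e => R.obj) (V.rhs e) := by
    rw [← cancel_mono (Limits.Sigma.map fun _ : V.vars e => h.hom), evalHom_comp, evalHom_comp]
    simp only [Sigma.ι_map, ← h.comp_evalHom]
    exact congrArg (h.hom ≫ ·) ((models_homAlg_iff V _ _).1 (hS _) e _)
  have hx : x = fun i => Limits.Sigma.ι (fun _ : V.vars e => R.obj) i ≫ Limits.Sigma.desc x :=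
    funext fun i => (Limits.Sigma.ι_desc x i).symm
  rw [hx, ← evalHom_comp, ← evalHom_comp, generic]

/-- The transport of a coalgebra structure along an isomorphism. -/
@[simps]
noncomputable def OpCoalg.transport (R : OpCoalg Ω A) {X : A} (i : R.obj ≅ X) :
    OpCoalg Ω A where
  obj := X
  coop α := i.inv ≫ R.coop α ≫ Limits.Sigma.map fun _ => i.hom

/-- The isomorphism from a coalgebra to its transport, as a morphism. -/
@[simps]
noncomputable def OpCoalg.toTransport (R : OpCoalg Ω A) {X : A} (i : R.obj ≅ X) :
    OpCoalg.Hom R (R.transport i) where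
  hom := i.hom
  comm _ := (i.hom_inv_id_assoc _).symm

namespace Coalg

variable {V : Variety Ω}

theorem base_comm {R S : Coalg A V} (f : R ⟶ S) (α : Ω.Op) :
    R.coop α ≫ Limits.Sigma.map (fun _ => base f) = base f ≫ S.coop α :=
  OpCoalg.Hom.comm f α

/-- A morphism of coalgebras from a compatible morphism of underlying objects. -/
def homMk {R S : Coalg A V} (f : R.obj ⟶ S.obj)
    (hf : ∀ α, R.coop α ≫ Limits.Sigma.map (fun _ => f) = f ≫ S.coop α) : R ⟶ S :=
  OpCoalg.Hom.mk f hf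

@[ext]
theorem hom_ext {R S : Coalg A V} {f g : R ⟶ S} (h : base f = base g) : f = g :=
  OpCoalg.Hom.ext h

@[simp]
theorem base_comp {R S T : Coalg A V} (f : R ⟶ S) (g : S ⟶ T) :
    base (f ≫ g) = base f ≫ base g := rfl

/-- The transport of a `V`-coalgebra along an isomorphism. -/
noncomputable def transport (R : Coalg A V) {X : A} (i : R.obj ≅ X) : Coalg A V where
  toOpCoalg := R.toOpCoalg.transport i
  cosat := OpCoalg.models_of_jointly_epi (J := Unit) (fun _ => R.cosat)
    (fun _ => R.toOpCoalg.toTransport i) fun _ _ h => (cancel_epi i.hom).1 (h ())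

/-- A coalgebra is isomorphic to any of its transports. -/
noncomputable def transportIso (R : Coalg A V) {X : A} (i : R.obj ≅ X) : R ≅ R.transport i where
  hom := R.toOpCoalg.toTransport i
  inv := OpCoalg.Hom.mk (R := R.toOpCoalg.transport i) i.inv fun α => by
    have key : (i.inv ≫ R.coop α ≫ Limits.Sigma.map fun _ => i.hom) ≫
        Limits.Sigma.map (fun _ => i.inv) = i.inv ≫ R.coop α := by
      rw [Category.assoc, Category.assoc, map_comp_map_of_eq i.hom_inv_id, sigma_map_id,
        Category.comp_id]
    exact key
  hom_inv_id := OpCoalg.Hom.ext i.hom_inv_id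
  inv_hom_id := OpCoalg.Hom.ext i.inv_hom_id

/-! ### Colimits of coalgebras. -/

section Colimits

variable {J : Type*} [Category J] (K : J ⥤ Coalg A V)

/-- A compatible family of morphisms from the underlying objects of a diagram of coalgebras. -/
def Compatible {X : A} (ι : ∀ j, (K.obj j).obj ⟶ X) : Prop :=
  ∀ ⦃i j⦄ (u : i ⟶ j), base (K.map u) ≫ ι j = ι i

/-- The object `X` is a colimit of the underlying objects of a diagram of coalgebras. -/
structure IsUnderlyingColimit {X : A} (ι : ∀ j, (K.obj j).obj ⟶ X) : Prop where
  compatible : Compatible K ι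
  exists_desc : ∀ {Y : A} (f : ∀ j, (K.obj j).obj ⟶ Y), Compatible K f →
    ∃ g : X ⟶ Y, ∀ j, ι j ≫ g = f j
  hom_ext : ∀ {Y : A} (f g : X ⟶ Y), (∀ j, ι j ≫ f = ι j ≫ g) → f = g

theorem isUnderlyingColimit_colimit [HasColimit (K ⋙ forget A V)] :
    IsUnderlyingColimit K (X := colimit (K ⋙ forget A V)) fun j => colimit.ι (K ⋙ forget A V) j where
  compatible _ _ u := colimit.w (K ⋙ forget A V) u
  exists_desc {Y} f hf :=
    ⟨colimit.desc (K ⋙ forget A V)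
      ⟨Y, { app := f, naturality := fun _ _ u => (hf u).trans (Category.comp_id _).symm }⟩,
      fun j => colimit.ι_desc _ j⟩
  hom_ext _ _ h := colimit.hom_ext h

variable {K} {X : A} {ι : ∀ j, (K.obj j).obj ⟶ X}

/-- Transition morphisms commute with the co-operations, so the co-operations followed by the maps
of copowers form a cocone. -/
theorem IsUnderlyingColimit.exists_coop (h : IsUnderlyingColimit K ι) (α : Ω.Op) :
    ∃ g : X ⟶ ∐ fun _ : Ω.arity α => X,
      ∀ j, ι j ≫ g = (K.obj j).coop α ≫ Limits.Sigma.map fun _ => ι j := by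
  refine h.exists_desc (fun j => (K.obj j).coop α ≫ Limits.Sigma.map fun _ => ι j) ?_
  intro i j u
  rw [← Category.assoc, ← base_comm, Category.assoc, map_comp_map_of_eq (h.compatible u)]

/-- The coalgebra structure on a colimit of the underlying objects. -/
noncomputable def IsUnderlyingColimit.opCoalg (h : IsUnderlyingColimit K ι) : OpCoalg Ω A where
  obj := X
  coop α := (h.exists_coop α).choose

/-- The coprojections of `IsUnderlyingColimit.opCoalg`. -/
noncomputable def IsUnderlyingColimit.opCoalgι (h : IsUnderlyingColimit K ι) (j : J) :
    OpCoalg.Hom (K.obj j).toOpCoalg h.opCoalg where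
  hom := ι j
  comm α := ((h.exists_coop α).choose_spec j).symm

/-- The `V`-coalgebra structure on a colimit of the underlying objects. -/
noncomputable def IsUnderlyingColimit.coalg (h : IsUnderlyingColimit K ι) : Coalg A V where
  toOpCoalg := h.opCoalg
  cosat := OpCoalg.models_of_jointly_epi (fun j => (K.obj j).cosat) h.opCoalgι h.hom_ext

/-- The cocone of coalgebras on a colimit of the underlying objects. -/
noncomputable def IsUnderlyingColimit.cocone (h : IsUnderlyingColimit K ι) : Cocone K where
  pt := h.coalg
  ι :=
    { app := h.opCoalgι
      naturality := fun _ _ u => OpCoalg.Hom.ext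
        ((h.compatible u).trans (Category.comp_id _).symm) }

/-- A cocone of coalgebras on a colimit of the underlying objects is a colimit. -/
noncomputable def isColimitOfUnderlying (c : Cocone K)
    (h : IsUnderlyingColimit K fun j => base (c.ι.app j)) : IsColimit c :=
  have hs (s : Cocone K) : Compatible K fun j => base (s.ι.app j) :=
    fun _ _ u => congrArg base (s.w u)
  { desc := fun s => homMk (h.exists_desc _ (hs s)).choose fun α => h.hom_ext _ _ fun j => by
      have e := (h.exists_desc _ (hs s)).choose_spec j
      rw [← Category.assoc, ← base_comm, Category.assoc, map_comp_map_of_eq e, ← Category.assoc, e,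
        base_comm]
    fac := fun s j => hom_ext ((h.exists_desc _ (hs s)).choose_spec j)
    uniq := fun s m hm => hom_ext (h.hom_ext _ _ fun j =>
      (congrArg base (hm j)).trans ((h.exists_desc _ (hs s)).choose_spec j).symm) }

instance hasColimitsOfShape [HasColimitsOfShape J A] : HasColimitsOfShape J (Coalg A V) where
  has_colimit K :=
    ⟨⟨(isUnderlyingColimit_colimit K).cocone,
      isColimitOfUnderlying _ (isUnderlyingColimit_colimit K)⟩⟩

instance hasColimitsOfSize [HasColimitsOfSize.{w, w'} A] :
    HasColimitsOfSize.{w, w'} (Coalg A V) where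

end Colimits

end Coalg

/-! ### Forgetting identities and some co-operations. -/

/-- The variety of all algebras of a given type. -/
def Variety.all (Ω : Signature.{u}) : Variety Ω where
  Idn := PEmpty
  vars := PEmpty.elim
  lhs i := i.elim
  rhs i := i.elim

/-- The underlying coalgebra of a smaller type. -/
@[simps obj coop]
def OpCoalg.restrict (R : OpCoalg Ω A) (s : Set Ω.Op) : OpCoalg (Ω.restrict s) A where
  obj := R.obj
  coop α := R.coop α.1

/-- An `Ω`-coalgebra as a coalgebra of the variety of all `Ω`-algebras. -/
@[simps toOpCoalg]
def OpCoalg.toCoalg (R : OpCoalg Ω A) : Coalg A (Variety.all Ω) where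
  toOpCoalg := R
  cosat _ e := e.elim

/-- The functor that forgets the identities and some of the co-operations. -/
@[simps obj]
noncomputable def Coalg.restrict (V : Variety Ω) (s : Set Ω.Op) :
    Coalg A V ⥤ Coalg A (Variety.all (Ω.restrict s)) where
  obj R := (R.toOpCoalg.restrict s).toCoalg
  map {R S} f := OpCoalg.Hom.mk (R := R.toOpCoalg.restrict s) (S := S.toOpCoalg.restrict s)
    (base f) fun α => base_comm f α.1

/-- Colimits on both sides are recognized on the same underlying objects. -/
instance Coalg.restrict_preservesColimitsOfShape {J : Type*} [Category J] [HasColimitsOfShape J A]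
    (V : Variety Ω) (s : Set Ω.Op) :
    PreservesColimitsOfShape J (Coalg.restrict (A := A) V s) where
  preservesColimit {K} :=
    let h := isUnderlyingColimit_colimit K
    preservesColimit_of_preserves_colimit_cocone
      (isColimitOfUnderlying h.cocone h)
      (isColimitOfUnderlying _ ⟨h.compatible, h.exists_desc, h.hom_ext⟩)

instance Coalg.restrict_preservesColimitsOfSize [HasColimitsOfSize.{w, w'} A]
    (V : Variety Ω) (s : Set Ω.Op) :
    PreservesColimitsOfSize.{w, w'} (Coalg.restrict (A := A) V s) where

end CoalgebrasInCategory

/-! ### Cocompleteness of a variety, and copowers presented by terms. -/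

namespace Variety

variable {Ω : Signature.{u}} (V : Variety Ω)

variable {V} in
@[ext]
theorem hom_ext {A B : V.Alg} {f g : A ⟶ B} (h : ∀ a, OpAlg.Hom.toFun f a = OpAlg.Hom.toFun g a) :
    f = g :=
  OpAlg.Hom.ext (funext h)

/-- A homomorphism from the underlying map. -/
def homMk {A B : V.Alg} (f : A.carrier → B.carrier)
    (hf : ∀ (α : Ω.Op) (a : Ω.arity α → A.carrier), f (A.op α a) = B.op α fun j => f (a j)) :
    A ⟶ B :=
  OpAlg.Hom.mk f hf

theorem Models.of_injective {V : Variety Ω} {A B : OpAlg Ω} (hB : V.Models B) (f : OpAlg.Hom A B)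
    (hf : Function.Injective f.toFun) : V.Models A := fun e x => hf <| by
  rw [Term.map_eval, Term.map_eval, hB e]

theorem Models.of_surjective {V : Variety Ω} {A B : OpAlg Ω} (hA : V.Models A) (f : OpAlg.Hom A B)
    (hf : Function.Surjective f.toFun) : V.Models B := fun e x => by
  obtain ⟨y, rfl⟩ : ∃ y : V.vars e → A.carrier, x = fun i => f.toFun (y i) :=
    ⟨fun i => (hf (x i)).choose, funext fun i => (hf (x i)).choose_spec.symm⟩
  rw [← Term.map_eval, ← Term.map_eval, hA e]

section Coequalizer

variable {V} {A B : V.Alg} (f g : A ⟶ B)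

/-- The congruence generated by identifying the images of two homomorphisms. -/
inductive CoeqRel : B.carrier → B.carrier → Prop
  | refl (b) : CoeqRel b b
  | symm {b c} : CoeqRel b c → CoeqRel c b
  | trans {b c d} : CoeqRel b c → CoeqRel c d → CoeqRel b d
  | congr (α : Ω.Op) {b c : Ω.arity α → B.carrier} :
      (∀ j, CoeqRel (b j) (c j)) → CoeqRel (B.op α b) (B.op α c)
  | glue (a : A.carrier) : CoeqRel (OpAlg.Hom.toFun f a) (OpAlg.Hom.toFun g a)

/-- `CoeqRel` as an equivalence relation. -/
def coeqSetoid : Setoid B.carrier where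
  r := CoeqRel f g
  iseqv := ⟨CoeqRel.refl, CoeqRel.symm, CoeqRel.trans⟩

/-- The quotient algebra of a congruence. -/
noncomputable def coeqOpAlg : OpAlg Ω where
  carrier := Quotient (coeqSetoid f g)
  op α q := Quotient.mk _ (B.op α fun j => (q j).out)

/-- The projection to the quotient algebra. -/
noncomputable def coeqProj : OpAlg.Hom B.toOpAlg (coeqOpAlg f g) where
  toFun := Quotient.mk (coeqSetoid f g)
  map_op α _ := Quotient.sound <| CoeqRel.congr α fun _ =>
    CoeqRel.symm (Quotient.mk_out (s := coeqSetoid f g) _)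

/-- The coequalizer of two homomorphisms. -/
noncomputable def coeq : V.Alg where
  toOpAlg := coeqOpAlg f g
  models := B.models.of_surjective (coeqProj f g) Quotient.mk_surjective

theorem CoeqRel.map_eq {C : V.Alg} {h : B ⟶ C} (w : f ≫ h = g ≫ h) {b c : B.carrier}
    (r : CoeqRel f g b c) : OpAlg.Hom.toFun h b = OpAlg.Hom.toFun h c := by
  induction r with
  | refl => rfl
  | symm _ ih => exact ih.symm
  | trans _ _ ih₁ ih₂ => exact ih₁.trans ih₂
  | congr α _ ih =>
    refine (OpAlg.Hom.map_op h α _).trans (Eq.trans ?_ (OpAlg.Hom.map_op h α _).symm)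
    exact congrArg _ (funext ih)
  | glue a => exact congrFun (congrArg OpAlg.Hom.toFun w) a

/-- The homomorphism from the coequalizer induced by a homomorphism that coequalizes. -/
noncomputable def coeqDesc {C : V.Alg} (h : B ⟶ C) (w : f ≫ h = g ≫ h) : coeq f g ⟶ C where
  toFun := Quotient.lift (s := coeqSetoid f g) (OpAlg.Hom.toFun h) fun _ _ r => r.map_eq f g w
  map_op α q := by
    obtain ⟨b, rfl⟩ : ∃ b : Ω.arity α → B.carrier, q = fun i => (coeqProj f g).toFun (b i) :=
      ⟨fun i => (q i).out, funext fun i => (Quotient.out_eq (q i)).symm⟩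
    exact (congrArg (Quotient.lift (s := coeqSetoid f g) (OpAlg.Hom.toFun h)
      fun _ _ r => r.map_eq f g w) ((coeqProj f g).map_op α b).symm).trans
      (OpAlg.Hom.map_op h α b)

instance : HasCoequalizers V.Alg := by
  refine @hasCoequalizers_of_hasColimit_parallelPair _ _ fun {A B f g} => ?_
  let p : B ⟶ coeq f g := coeqProj f g
  have hp : f ≫ p = g ≫ p := by
    ext a
    exact Quotient.sound (CoeqRel.glue a)
  exact ⟨⟨_, Cofork.IsColimit.mk' (Cofork.ofπ p hp) fun s =>
    ⟨coeqDesc f g s.π s.condition, rfl, fun {m} hm => by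
      ext q
      obtain ⟨b, rfl⟩ := Quotient.mk_surjective q
      exact congrFun (congrArg OpAlg.Hom.toFun hm) b⟩⟩⟩

instance : HasColimits V.Alg := has_colimits_of_hasCoequalizers_and_coproducts

end Coequalizer

/-! ### Copowers -/

section Copower

variable {V} {ι : Type u}

/-- The homomorphism of copowers in term presentation induced by a homomorphism. -/
noncomputable def coprodMap {A B : V.Alg} (f : A ⟶ B) :
    V.coprod (fun _ : ι => A) ⟶ V.coprod (fun _ : ι => B) :=
  V.coprodDesc _ fun i => f ≫ V.coprodInj (fun _ => B) i

/-- The comparison of the chosen copower with the one in term presentation. -/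
noncomputable def copowerIso (ι : Type u) (A : V.Alg) :
    (∐ fun _ : ι => A) ≅ V.coprod (fun _ : ι => A) :=
  (coproductIsCoproduct _).coconePointUniqueUpToIso (V.coprodIsColimit _)

theorem ι_copowerIso_hom (A : V.Alg) (i : ι) :
    Limits.Sigma.ι (fun _ : ι => A) i ≫ (copowerIso ι A).hom = V.coprodInj (fun _ : ι => A) i :=
  (coproductIsCoproduct _).comp_coconePointUniqueUpToIso_hom (V.coprodIsColimit _) ⟨i⟩

theorem coprodInj_coprodDesc {A : ι → V.Alg} {B : V.Alg} (f : ∀ i, A i ⟶ B) (i : ι) :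
    V.coprodInj A i ≫ V.coprodDesc A f = f i := rfl

theorem map_copowerIso_hom {A B : V.Alg} (f : A ⟶ B) :
    Limits.Sigma.map (fun _ : ι => f) ≫ (copowerIso ι B).hom =
      (copowerIso ι A).hom ≫ coprodMap f :=
  Limits.Sigma.hom_ext _ _ fun i => by
    rw [← Category.assoc, ← Category.assoc, Sigma.ι_map, ι_copowerIso_hom, Category.assoc,
      ι_copowerIso_hom, coprodMap, coprodInj_coprodDesc]

/-- The map of terms induced by a map of elements. -/
def mapTerm {X Y : Type u} (f : X → Y) (t : Term Ω (Σ _ : ι, X)) : Term Ω (Σ _ : ι, Y) :=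
  t.subst fun p => .var ⟨p.1, f p.2⟩

theorem mapTerm_comp {X Y Z : Type u} (f : X → Y) (g : Y → Z) (t : Term Ω (Σ _ : ι, X)) :
    mapTerm g (mapTerm f t) = mapTerm (g ∘ f) t := by
  induction t with
  | var p => rfl
  | op α t ih => exact congrArg (Term.op α) (funext ih)

theorem coprodMap_mk {A B : V.Alg} (f : A ⟶ B) (t : Term Ω (Σ _ : ι, A.carrier)) :
    OpAlg.Hom.toFun (coprodMap (ι := ι) f) (Quotient.mk (V.coprodSetoid fun _ : ι => A) t) =
      Quotient.mk (V.coprodSetoid fun _ : ι => B) (mapTerm (OpAlg.Hom.toFun f) t) :=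
  V.coprodOpAlg_eval_mk (fun _ : ι => B) (κ := Σ _ : ι, A.carrier)
    (fun p => .var ⟨p.1, OpAlg.Hom.toFun f p.2⟩) t

end Copower

end Variety

/-! ### The cardinal bound. -/

/-- An infinite set of places that is at least as large as each arity. -/
def Places (Ω : Signature.{u}) : Type u :=
  ULift.{u} ℕ ⊕ Σ α : Ω.Op, Ω.arity α

section Places

open Cardinal

variable {Ω : Signature.{u}}

instance : Infinite (Places Ω) := inferInstanceAs (Infinite (_ ⊕ _))

/-- The places that belong to an operation symbol. -/
def Places.arg (α : Ω.Op) (j : Ω.arity α) : Places Ω := .inr ⟨α, j⟩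

theorem Places.arg_injective (α : Ω.Op) : Function.Injective (Places.arg α) := fun _ _ h =>
  eq_of_heq (Sigma.mk.inj (Sum.inr.inj h)).2

/-- This and the two embeddings below are absorption in infinite cardinals; they merge several
tuples indexed by places into a single one. -/
theorem Places.exists_embedding_sum : Nonempty ((Places Ω ⊕ Places Ω) ↪ Places Ω) := by
  rw [← Cardinal.le_def, ← add_def, add_eq_self (aleph0_le_mk _)]

theorem Places.exists_embedding_option (α : Ω.Op) :
    Nonempty (Option (Ω.arity α) ↪ Places Ω) := by
  rw [← Cardinal.le_def, mk_option]
  exact (add_le_add (mk_le_of_injective (Places.arg_injective α)) le_rfl).trans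
    (add_one_eq (aleph0_le_mk _)).le

theorem Places.exists_embedding_prod (α : Ω.Op) :
    Nonempty ((Ω.arity α × Places Ω) ↪ Places Ω) := by
  rw [← Cardinal.le_def, mk_prod, lift_id, lift_id]
  exact (mul_le_mul_left (mk_le_of_injective (Places.arg_injective α)) _).trans
    (mul_eq_self (aleph0_le_mk _)).le

end Places

/-! ### Boundedness of terms and of equalities in copowers. -/

namespace Variety

variable {Ω : Signature.{u}} {V : Variety Ω} {ι : Type u}

/-- A term involves no more elements than there are places. -/
theorem exists_mapTerm_eq {X : Type u} [Nonempty X] (t : Term Ω (Σ _ : ι, X)) :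
    ∃ (z : Places Ω → X) (s : Term Ω (Σ _ : ι, Places Ω)), mapTerm z s = t := by
  induction t with
  | var p => exact ⟨fun _ => p.2, .var ⟨p.1, Classical.arbitrary _⟩, rfl⟩
  | op α t ih =>
    choose z s h using ih
    -- The tuples of the `arity α` many subterms are stored side by side along `φ`; unused places
    -- receive an arbitrary element.
    obtain ⟨φ⟩ := Places.exists_embedding_prod α
    refine ⟨Function.extend φ (fun p => z p.1 p.2) fun _ => Classical.arbitrary X,
      .op α fun j => mapTerm (fun k => φ (j, k)) (s j), congrArg (Term.op α) (funext fun j => ?_)⟩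
    refine (mapTerm_comp _ _ _).trans (Eq.trans ?_ (h j))
    congr 1
    funext k
    exact φ.injective.extend_apply _ _ (j, k)

theorem exists_mapTerm_eq_pair {X : Type u} [Nonempty X] (t₁ t₂ : Term Ω (Σ _ : ι, X)) :
    ∃ (z : Places Ω → X) (s₁ s₂ : Term Ω (Σ _ : ι, Places Ω)),
      mapTerm z s₁ = t₁ ∧ mapTerm z s₂ = t₂ := by
  obtain ⟨z₁, s₁, h₁⟩ := exists_mapTerm_eq t₁
  obtain ⟨z₂, s₂, h₂⟩ := exists_mapTerm_eq t₂
  obtain ⟨φ⟩ := Places.exists_embedding_sum (Ω := Ω)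
  refine ⟨Function.extend φ (Sum.elim z₁ z₂) fun _ => Classical.arbitrary X,
    mapTerm (fun k => φ (.inl k)) s₁, mapTerm (fun k => φ (.inr k)) s₂, ?_, ?_⟩
  · refine (mapTerm_comp _ _ _).trans (Eq.trans ?_ h₁)
    congr 1
    funext k
    exact φ.injective.extend_apply _ _ (.inl k)
  · refine (mapTerm_comp _ _ _).trans (Eq.trans ?_ h₂)
    congr 1
    funext k
    exact φ.injective.extend_apply _ _ (.inr k)

theorem mapTerm_subst {X Y κ : Type u} (f : X → Y) (x : κ → Term Ω (Σ _ : ι, X)) (t : Term Ω κ) :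
    mapTerm f (t.subst x) = t.subst fun i => mapTerm f (x i) := by
  induction t with
  | var i => rfl
  | op α t ih => exact congrArg (Term.op α) (funext ih)

/-- The equality of two elements of a copower of `A` is witnessed by no more elements of `A` than
there are places: it holds in the copower of any subalgebra that contains these witnesses. -/
theorem CoprodRel.exists_witnesses {A : V.Alg} [Nonempty A.carrier]
    {s t : Term Ω (Σ _ : ι, A.carrier)} (h : V.CoprodRel (fun _ : ι => A) s t) :
    ∃ y : Places Ω → A.carrier, ∀ (B : V.Alg) (i : B ⟶ A) (r : A.carrier → B.carrier),
      Function.Injective (OpAlg.Hom.toFun i) → (∀ k, OpAlg.Hom.toFun i (r (y k)) = y k) →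
        V.CoprodRel (fun _ : ι => B) (mapTerm r s) (mapTerm r t) := by
  induction h with
  | refl s => exact ⟨fun _ => Classical.arbitrary _, fun _ _ _ _ _ => .refl _⟩
  | symm _ ih =>
    obtain ⟨y, hy⟩ := ih
    exact ⟨y, fun B i r hi hr => (hy B i r hi hr).symm⟩
  | trans _ _ ih₁ ih₂ =>
    obtain ⟨y₁, h₁⟩ := ih₁
    obtain ⟨y₂, h₂⟩ := ih₂
    obtain ⟨φ⟩ := Places.exists_embedding_sum (Ω := Ω)
    refine ⟨Function.extend φ (Sum.elim y₁ y₂) fun _ => Classical.arbitrary _,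
      fun B i r hi hr => (h₁ B i r hi fun k => ?_).trans (h₂ B i r hi fun k => ?_)⟩
    · simpa [φ.injective.extend_apply] using hr (φ (.inl k))
    · simpa [φ.injective.extend_apply] using hr (φ (.inr k))
  | congr α _ ih =>
    choose y h using ih
    obtain ⟨φ⟩ := Places.exists_embedding_prod α
    refine ⟨Function.extend φ (fun p => y p.1 p.2) fun _ => Classical.arbitrary _,
      fun B i r hi hr => CoprodRel.congr α fun j => h j B i r hi fun k => ?_⟩
    simpa [φ.injective.extend_apply] using hr (φ (j, k))
  | table l α a =>
    -- The witnesses are the arguments `a j` (at `some j`) and the value of the operation (at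
    -- `none`).
    obtain ⟨φ⟩ := Places.exists_embedding_option α
    refine ⟨Function.extend φ (fun o => o.elim (A.op α a) a) fun _ => Classical.arbitrary _,
      fun B i r hi hr => ?_⟩
    have h₁ : OpAlg.Hom.toFun i (r (A.op α a)) = A.op α a := by
      simpa [φ.injective.extend_apply] using hr (φ none)
    have h₂ : ∀ j, OpAlg.Hom.toFun i (r (a j)) = a j := fun j => by
      simpa [φ.injective.extend_apply] using hr (φ (some j))
    -- The map `r` is no homomorphism, but it respects this one application because `i` is injective
    -- and recovers all the elements involved.
    have h₃ : r (A.op α a) = B.op α fun j => r (a j) := hi <| by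
      rw [OpAlg.Hom.map_op, h₁]
      exact congrArg (A.op α) (funext fun j => (h₂ j).symm)
    change V.CoprodRel (fun _ : ι => B) (.op α fun j => .var ⟨l, r (a j)⟩)
      (.var ⟨l, r (A.op α a)⟩)
    rw [h₃]
    exact CoprodRel.table (A := fun _ : ι => B) l α _
  | ident e x =>
    refine ⟨fun _ => Classical.arbitrary _, fun B i r _ _ => ?_⟩
    rw [mapTerm_subst, mapTerm_subst]
    exact CoprodRel.ident e _

/-- An element of a copower, as a term. -/
theorem exists_copower_mk {A : V.Alg} (x : (∐ fun _ : ι => A : V.Alg).carrier) :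
    ∃ t : Term Ω (Σ _ : ι, A.carrier), OpAlg.Hom.toFun (copowerIso ι A).hom x =
      Quotient.mk (V.coprodSetoid fun _ : ι => A) t :=
  (Quotient.exists_rep _).imp fun _ h => h.symm

theorem toFun_injective_of_iso {A B : V.Alg} (e : A ≅ B) :
    Function.Injective (OpAlg.Hom.toFun e.hom) :=
  Function.LeftInverse.injective (g := OpAlg.Hom.toFun e.inv)
    fun a => congrFun (congrArg OpAlg.Hom.toFun e.hom_inv_id) a

theorem toFun_surjective_of_iso {A B : V.Alg} (e : A ≅ B) :
    Function.Surjective (OpAlg.Hom.toFun e.hom) :=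
  Function.RightInverse.surjective (g := OpAlg.Hom.toFun e.inv)
    fun a => congrFun (congrArg OpAlg.Hom.toFun e.inv_hom_id) a

theorem toFun_map_copowerIso {A B : V.Alg} (f : A ⟶ B) (x : (∐ fun _ : ι => A : V.Alg).carrier) :
    OpAlg.Hom.toFun (copowerIso ι B).hom
        (OpAlg.Hom.toFun (Limits.Sigma.map fun _ : ι => f) x) =
      OpAlg.Hom.toFun (coprodMap f) (OpAlg.Hom.toFun (copowerIso ι A).hom x) :=
  congrFun (congrArg OpAlg.Hom.toFun (map_copowerIso_hom f)) x

theorem mono_of_injective {A B : V.Alg} {f : A ⟶ B}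
    (hf : Function.Injective (OpAlg.Hom.toFun f)) : Mono f :=
  ⟨fun _ _ e => hom_ext fun a => hf (congrFun (congrArg OpAlg.Hom.toFun e) a)⟩

/-- A homomorphism whose values lie in the image of an injective homomorphism factors through
it. -/
theorem exists_lift {X Y Z : V.Alg} (f : X ⟶ Z) {m : Y ⟶ Z}
    (hm : Function.Injective (OpAlg.Hom.toFun m))
    (h : ∀ x, ∃ y, OpAlg.Hom.toFun m y = OpAlg.Hom.toFun f x) : ∃ g : X ⟶ Y, g ≫ m = f := by
  choose g hg using h
  refine ⟨homMk V g fun α a => hm ?_, hom_ext hg⟩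
  rw [hg, OpAlg.Hom.map_op, OpAlg.Hom.map_op]
  exact congrArg _ (funext fun j => (hg (a j)).symm)

end Variety

/-! ### Small subcoalgebras -/

section Subcoalgebras

variable {ΩC ΩD : Signature.{u}} {C : Variety ΩC} {D : Variety ΩD}

variable (D) in
/-- The index sets of the copowers relevant to `D`-coalgebras. -/
abbrev copowerIndex (i : ΩD.Op ⊕ D.Idn) : Type u :=
  Sum.elim ΩD.arity D.vars i

variable (ΩC D) in
/-- The operation symbols under which the subsets that carry subcoalgebras are closed. -/
inductive ClosureOp : Type u
  | base (α : ΩC.Op)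
  -- One operation for each pair of terms and each place: it returns the element at that place of a
  -- witnessing tuple for the equality of the two terms, if they are equal in the copower.
  | witness (i : ΩD.Op ⊕ D.Idn) (s t : Term ΩC (Σ _ : copowerIndex D i, Places ΩC))
      (k : Places ΩC)
  | coop (α : ΩD.Op) (k : Places ΩC)

variable (ΩC D) in
/-- The type of algebras whose subalgebras carry subcoalgebras. -/
def closureSignature : Signature.{u} where
  Op := ClosureOp ΩC D
  arity _ := Places ΩC

namespace Coalg

variable (Q : Coalg C.Alg D)

/-- The tuple precedes the hypothesis that the terms are congruent, so that it can be chosen for all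
pairs and define a total operation; for other pairs its value is irrelevant. -/
theorem exists_witnesses {i : ΩD.Op ⊕ D.Idn} [Nonempty Q.obj.carrier]
    (s t : Term ΩC (Σ _ : copowerIndex D i, Q.obj.carrier)) :
    ∃ y : Places ΩC → Q.obj.carrier, C.CoprodRel (fun _ => Q.obj) s t →
      ∀ (B : C.Alg) (i : B ⟶ Q.obj) (r : Q.obj.carrier → B.carrier),
        Function.Injective (OpAlg.Hom.toFun i) → (∀ k, OpAlg.Hom.toFun i (r (y k)) = y k) →
          C.CoprodRel (fun _ => B) (Variety.mapTerm r s) (Variety.mapTerm r t) := by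
  by_cases h : C.CoprodRel (fun _ => Q.obj) s t
  · exact h.exists_witnesses.imp fun _ hy _ => hy
  · exact ⟨fun _ => Classical.arbitrary _, fun h' => (h h').elim⟩

theorem exists_coop_eq (α : ΩD.Op) (x : Q.obj.carrier) :
    ∃ (z : Places ΩC → Q.obj.carrier) (t : Term ΩC (Σ _ : ΩD.arity α, Places ΩC)),
      OpAlg.Hom.toFun (Variety.copowerIso _ Q.obj).hom (OpAlg.Hom.toFun (Q.coop α) x) =
        Quotient.mk (C.coprodSetoid fun _ => Q.obj) (Variety.mapTerm z t) := by
  obtain ⟨t, ht⟩ := Variety.exists_copower_mk (OpAlg.Hom.toFun (Q.coop α) x)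
  have : Nonempty Q.obj.carrier := ⟨x⟩
  obtain ⟨z, s, rfl⟩ := Variety.exists_mapTerm_eq t
  exact ⟨z, s, ht⟩

/-- The operations under which the subsets that carry subcoalgebras are closed. -/
noncomputable def closureAlg : OpAlg (closureSignature ΩC D) where
  carrier := Q.obj.carrier
  op
    | .base α, z => Q.obj.op α fun j => z (Places.arg α j)
    | .witness _ s t k, z =>
      have : Nonempty Q.obj.carrier := ⟨z (Classical.arbitrary (Places ΩC))⟩
      (Q.exists_witnesses (Variety.mapTerm z s) (Variety.mapTerm z t)).choose k
    -- Essentially unary: only the entry of `z` at one fixed place is used.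
    | .coop α k, z => (Q.exists_coop_eq α (z (Classical.arbitrary (Places ΩC)))).choose k

/-- The nonempty subsets closed under the operations of `closureAlg`. -/
structure ClosedSubset where
  carrier : Set Q.obj.carrier
  nonempty : carrier.Nonempty
  op_mem : ∀ (o : ClosureOp ΩC D) (z : Places ΩC → Q.obj.carrier), (∀ k, z k ∈ carrier) →
    Q.closureAlg.op o z ∈ carrier

namespace ClosedSubset

variable {Q} (S : Q.ClosedSubset)

instance : Nonempty S.carrier := S.nonempty.to_subtype

theorem base_op_mem (α : ΩC.Op) (a : ΩC.arity α → S.carrier) :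
    Q.obj.op α (fun j => (a j : Q.obj.carrier)) ∈ S.carrier := by
  let z : Places ΩC → S.carrier :=
    Function.extend (Places.arg α) a fun _ => Classical.arbitrary _
  have h := S.op_mem (.base α) (fun k => z k) fun k => (z k).2
  have hz : ∀ j, z (Places.arg α j) = a j := (Places.arg_injective α).extend_apply _ _
  simpa only [closureAlg, hz] using h

/-- A closed subset as an algebra. -/
def opAlg : OpAlg ΩC where
  carrier := S.carrier
  op α a := ⟨_, S.base_op_mem α a⟩

/-- The inclusion of a closed subset as a homomorphism of algebras. -/
def opIncl : OpAlg.Hom S.opAlg Q.obj.toOpAlg := ⟨Subtype.val, fun _ _ => rfl⟩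

/-- A closed subset as an algebra of the variety. -/
def alg : C.Alg where
  toOpAlg := S.opAlg
  models := Q.obj.models.of_injective S.opIncl Subtype.val_injective

/-- The inclusion of a closed subset. -/
def incl : S.alg ⟶ Q.obj := S.opIncl

theorem incl_injective : Function.Injective (OpAlg.Hom.toFun S.incl) := Subtype.val_injective

/-- The heart of the construction: a derivation in the copower of `Q.obj` can be carried out inside
`S`, because `S` contains witnesses for it. -/
theorem coprodRel_of_map {i : ΩD.Op ⊕ D.Idn}
    (s t : Term ΩC (Σ _ : copowerIndex D i, S.carrier))
    (h : C.CoprodRel (fun _ => Q.obj) (Variety.mapTerm Subtype.val s)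
      (Variety.mapTerm Subtype.val t)) :
    C.CoprodRel (fun _ => S.alg) s t := by
  classical
  obtain ⟨z, s, t, rfl, rfl⟩ := Variety.exists_mapTerm_eq_pair s t
  rw [Variety.mapTerm_comp, Variety.mapTerm_comp] at h
  have : Nonempty Q.obj.carrier := ⟨S.nonempty.some⟩
  have hy := (Q.exists_witnesses (Variety.mapTerm (Subtype.val ∘ z) s)
    (Variety.mapTerm (Subtype.val ∘ z) t)).choose_spec h
  have hS := fun k => S.op_mem (.witness i s t k) (Subtype.val ∘ z) fun k => (z k).2
  -- A retraction onto `S`, arbitrary outside. It fixes the witnesses, which lie in `S` by `hS`, and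
  -- the elements `z k`, so it turns the congruence in `Q.obj` back into one between the original
  -- terms.
  let r : Q.obj.carrier → S.carrier :=
    fun x => if hx : x ∈ S.carrier then ⟨x, hx⟩ else Classical.arbitrary _
  have hr : ∀ x, x ∈ S.carrier → (r x : Q.obj.carrier) = x := fun x hx => by simp [r, hx]
  have key := hy S.alg S.incl r S.incl_injective fun k => hr _ (hS k)
  have hz : r ∘ Subtype.val ∘ z = z := funext fun k => Subtype.ext (hr _ (z k).2)
  have e₁ := Variety.mapTerm_comp (Subtype.val ∘ z) r s
  have e₂ := Variety.mapTerm_comp (Subtype.val ∘ z) r t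
  rw [hz] at e₁ e₂
  rw [← e₁, ← e₂]
  exact key

/-- The inclusion of a closed subset induces injections of the relevant copowers. -/
theorem map_incl_injective (i : ΩD.Op ⊕ D.Idn) :
    Function.Injective
      (OpAlg.Hom.toFun (Limits.Sigma.map fun _ : copowerIndex D i => S.incl)) := by
  intro x y h
  apply Variety.toFun_injective_of_iso (Variety.copowerIso _ _)
  replace h := congrArg (OpAlg.Hom.toFun (Variety.copowerIso _ _).hom) h
  rw [Variety.toFun_map_copowerIso, Variety.toFun_map_copowerIso] at h
  obtain ⟨s, hs⟩ := Variety.exists_copower_mk x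
  obtain ⟨t, ht⟩ := Variety.exists_copower_mk y
  rw [hs, ht] at h ⊢
  rw [Variety.coprodMap_mk, Variety.coprodMap_mk] at h
  exact Quotient.sound (S.coprodRel_of_map s t (Quotient.exact h))

/-- The co-operations map a closed subset to the image of its copower. -/
theorem exists_map_incl_eq_coop (α : ΩD.Op) (x : S.carrier) :
    ∃ y, OpAlg.Hom.toFun (Limits.Sigma.map fun _ : ΩD.arity α => S.incl) y =
      OpAlg.Hom.toFun (S.incl ≫ Q.coop α) x := by
  obtain ⟨t, ht⟩ := (Q.exists_coop_eq α x).choose_spec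
  -- By closure under `.coop`, the elements of `Q.obj` occurring in a term for the value at `x`
  -- belong to `S`, so this term already defines an element of the copower of `S.alg`.
  have hS := fun k => S.op_mem (.coop α k) (fun _ => x) fun _ => x.2
  let z : Places ΩC → S.carrier := fun k => ⟨_, hS k⟩
  obtain ⟨y, hy⟩ := Variety.toFun_surjective_of_iso (Variety.copowerIso (ΩD.arity α) S.alg)
    (Quotient.mk (C.coprodSetoid fun _ => S.alg) (Variety.mapTerm z t))
  refine ⟨y, Variety.toFun_injective_of_iso (Variety.copowerIso _ _) ?_⟩
  rw [Variety.toFun_map_copowerIso, hy, Variety.coprodMap_mk]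
  refine Eq.trans ?_ ht.symm
  exact congrArg _ (Variety.mapTerm_comp z Subtype.val t)

theorem exists_coop (α : ΩD.Op) :
    ∃ g : S.alg ⟶ ∐ fun _ : ΩD.arity α => S.alg,
      g ≫ Limits.Sigma.map (fun _ => S.incl) = S.incl ≫ Q.coop α :=
  Variety.exists_lift _ (S.map_incl_injective (.inl α)) (S.exists_map_incl_eq_coop α)

/-- A closed subset as a coalgebra. -/
noncomputable def opCoalg : OpCoalg ΩD C.Alg where
  obj := S.alg
  coop α := (S.exists_coop α).choose

/-- The inclusion of a closed subset as a morphism of coalgebras. -/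
noncomputable def opCoalgIncl : OpCoalg.Hom S.opCoalg Q.toOpCoalg where
  hom := S.incl
  comm α := (S.exists_coop α).choose_spec

/-- A closed subset as a `D`-coalgebra. -/
noncomputable def coalg : Coalg C.Alg D where
  toOpCoalg := S.opCoalg
  cosat := S.opCoalgIncl.models_of_mono Q.cosat
    fun e => Variety.mono_of_injective (S.map_incl_injective (.inr e))

/-- The inclusion of a closed subset as a morphism of `D`-coalgebras. -/
noncomputable def coalgIncl : S.coalg ⟶ Q := S.opCoalgIncl

/-- The inclusion of a closed subset in a larger one. -/
def inclOfLE {S T : Q.ClosedSubset} (h : S.carrier ⊆ T.carrier) : S.alg ⟶ T.alg :=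
  OpAlg.Hom.mk (A := S.opAlg) (B := T.opAlg) (Set.inclusion h) fun _ _ => rfl

/-- The inclusion of a closed subset in a larger one is a morphism of coalgebras. -/
theorem exists_coalg_hom_of_le {S T : Q.ClosedSubset} (h : S.carrier ⊆ T.carrier) :
    ∃ f : S.coalg ⟶ T.coalg, base f = inclOfLE h ∧ f ≫ T.coalgIncl = S.coalgIncl := by
  have e : inclOfLE h ≫ T.incl = S.incl := rfl
  have (α : ΩD.Op) : Mono (Limits.Sigma.map fun _ : ΩD.arity α => T.opCoalgIncl.hom) :=
    Variety.mono_of_injective (T.map_incl_injective (.inl α))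
  exact ⟨OpCoalg.Hom.mk (R := S.opCoalg) (S := T.opCoalg) (inclOfLE h)
    fun α => T.opCoalgIncl.comm_of_comp_eq S.opCoalgIncl e α, rfl, rfl⟩

/-- The closed subset generated by a family of elements. -/
noncomputable def generate (g : Places ΩC → Q.obj.carrier) : Q.ClosedSubset where
  carrier := Set.range (Term.eval Q.closureAlg g)
  nonempty := ⟨_, .var (Classical.arbitrary (Places ΩC)), rfl⟩
  op_mem o z hz := by
    choose t ht using hz
    obtain rfl : (fun k => (t k).eval Q.closureAlg g) = z := funext ht
    exact ⟨.op (Ω := closureSignature ΩC D) o t, rfl⟩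

theorem mem_generate (g : Places ΩC → Q.obj.carrier) (k : Places ΩC) :
    g k ∈ (generate g).carrier :=
  ⟨.var k, rfl⟩

theorem generate_subset {g : Places ΩC → Q.obj.carrier} {S : Q.ClosedSubset}
    (h : ∀ k, g k ∈ S.carrier) : (generate g).carrier ⊆ S.carrier := by
  rintro _ ⟨t, rfl⟩
  induction t with
  | var k => exact h k
  | op o t ih => exact S.op_mem o _ ih

end ClosedSubset

end Coalg

/-! ### Essential smallness of the bounded coalgebras. -/

/-- The coalgebras with at most as many elements as `T`. -/
def boundedCoalg (C : Variety ΩC) (D : Variety ΩD) (T : Type u) :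
    ObjectProperty (Coalg C.Alg D) :=
  fun Q => ∃ f : T → Q.obj.carrier, Function.Surjective f

/-- Evaluation at `g` maps the terms onto the generated subset; the bound depends neither on `Q` nor
on `g`. -/
theorem boundedCoalg_generate {Q : Coalg C.Alg D} (g : Places ΩC → Q.obj.carrier) :
    boundedCoalg C D (Term (closureSignature ΩC D) (Places ΩC))
      (Coalg.ClosedSubset.generate g).coalg :=
  ⟨Set.rangeFactorization _, Set.rangeFactorization_surjective⟩

/-- The algebras of `C` on a quotient of `T`. -/
structure QuotientAlg (C : Variety ΩC) (T : Type u) : Type u where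
  rel : Setoid T
  op : ∀ α : ΩC.Op, (ΩC.arity α → Quotient rel) → Quotient rel
  models : C.Models ⟨Quotient rel, op⟩

/-- A `QuotientAlg` as an algebra. -/
def QuotientAlg.alg {T : Type u} (X : QuotientAlg C T) : C.Alg := ⟨⟨Quotient X.rel, X.op⟩, X.models⟩

/-- An algebra with at most as many elements as `T` is isomorphic to one on a quotient of `T`. -/
theorem QuotientAlg.exists_iso {T : Type u} (A : C.Alg) (f : T → A.carrier)
    (hf : Function.Surjective f) : ∃ X : QuotientAlg C T, Nonempty (A ≅ X.alg) := by
  let e : Quotient (Setoid.ker f) ≃ A.carrier := Setoid.quotientKerEquivOfSurjective f hf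
  let op : ∀ α : ΩC.Op, (ΩC.arity α → Quotient (Setoid.ker f)) → Quotient (Setoid.ker f) :=
    fun α a => e.symm (A.op α fun j => e (a j))
  let i : OpAlg.Hom ⟨_, op⟩ A.toOpAlg := ⟨e, fun α a => e.apply_symm_apply _⟩
  let X : QuotientAlg C T := ⟨Setoid.ker f, op, A.models.of_injective i e.injective⟩
  refine ⟨X, ⟨⟨OpAlg.Hom.mk (B := X.alg.toOpAlg) e.symm fun α a => ?_, i, ?_, ?_⟩⟩⟩
  · exact congrArg e.symm (congrArg (A.op α) (funext fun j => (e.apply_symm_apply (a j)).symm))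
  · exact Variety.hom_ext e.apply_symm_apply
  · exact Variety.hom_ext e.symm_apply_apply

instance essentiallySmall_boundedCoalg (T : Type u) :
    ObjectProperty.EssentiallySmall.{u} (boundedCoalg C D T) where
  exists_small_le' := by
    -- A small type of representatives: coalgebra structures on algebras carried by quotients of
    -- `T`.
    let ι := Σ X : QuotientAlg C T,
      { c : ∀ α : ΩD.Op, X.alg ⟶ ∐ fun _ : ΩD.arity α => X.alg //
        ∀ B, D.Models (OpCoalg.homAlg ⟨X.alg, c⟩ B) }
    let F : ι → Coalg C.Alg D := fun p => ⟨⟨p.1.alg, p.2.1⟩, p.2.2⟩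
    refine ⟨ObjectProperty.ofObj F, inferInstance, ?_⟩
    rintro Q ⟨f, hf⟩
    obtain ⟨X, ⟨i⟩⟩ := QuotientAlg.exists_iso Q.obj f hf
    exact ⟨_, ⟨(⟨X, _, (Q.transport i).cosat⟩ : ι)⟩, ⟨Q.transportIso i⟩⟩

end Subcoalgebras

/-! ### Gluing, and the terminal coalgebra over a given one. -/

section Cofree

variable {ΩC ΩD : Signature.{u}} {C : Variety ΩC} {D : Variety ΩD}

namespace Coalg.ClosedSubset

variable {Q : Coalg C.Alg D}

/-- Compatible morphisms from the generated closed subsets of a coalgebra glue. -/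
theorem exists_glue {R : Coalg C.Alg D}
    (k : ∀ g : Places ΩC → Q.obj.carrier, (generate g).coalg ⟶ R)
    (hk : ∀ {g g'} (f : (generate g).coalg ⟶ (generate g').coalg),
      f ≫ (generate g').coalgIncl = (generate g).coalgIncl → f ≫ k g' = k g) :
    ∃ f : Q ⟶ R, ∀ g, (generate g).coalgIncl ≫ f = k g := by
  let v (g) : (generate g).carrier → R.obj.carrier := OpAlg.Hom.toFun (base (k g))
  let c (x : Q.obj.carrier) : (generate fun _ : Places ΩC => x).carrier :=
    ⟨x, mem_generate (fun _ => x) (Classical.arbitrary _)⟩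
  -- The value at `x` is read off the subset generated by `x` alone; `hv` shows that any generated
  -- subset containing `x` gives the same value.
  let h (x : Q.obj.carrier) : R.obj.carrier := v _ (c x)
  have hv (g) (x : (generate g).carrier) : h x = v g x := by
    obtain ⟨f, hf, hi⟩ := exists_coalg_hom_of_le (Q := Q)
      (generate_subset (g := fun _ => (x : Q.obj.carrier)) (S := generate g) fun _ => x.2)
    have e := congrArg base (hk f hi)
    rw [base_comp, hf] at e
    exact (congrFun (congrArg OpAlg.Hom.toFun e) (c x)).symm
  let H : Q.obj ⟶ R.obj := Variety.homMk C h fun α a => by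
    -- `Q` may be empty in general, but here the value of an operation provides an element.
    have : Nonempty Q.obj.carrier := ⟨Q.obj.op α a⟩
    -- All arguments are listed in one tuple, so they lie in a common generated subset, on which the
    -- glued map is a homomorphism.
    let g : Places ΩC → Q.obj.carrier :=
      Function.extend (Places.arg α) a fun _ => Classical.arbitrary _
    have hg (j) : g (Places.arg α j) = a j := (Places.arg_injective α).extend_apply _ _ _
    let b (j) : (generate g).carrier := ⟨a j, hg j ▸ mem_generate g _⟩
    have hb : R.obj.op α (fun j => h (a j)) = R.obj.op α fun j => v g (b j) :=
      congrArg (R.obj.op α) (funext fun j => hv g (b j))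
    rw [hb]
    exact (hv g ⟨_, (generate g).base_op_mem α b⟩).trans (OpAlg.Hom.map_op (base (k g)) α b)
  have hH (g) : (generate g).incl ≫ H = base (k g) := Variety.hom_ext (hv g)
  refine ⟨homMk H fun α => ?_, fun g => hom_ext (hH g)⟩
  refine Variety.hom_ext fun x => ?_
  let S := generate (Q := Q) fun _ => x
  -- The square for `α` is tested one element at a time, on the subcoalgebra generated by that
  -- element.
  have key : S.incl ≫ Q.coop α ≫ Limits.Sigma.map (fun _ => H) = S.incl ≫ H ≫ R.coop α := by
    have h₁ := base_comm S.coalgIncl α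
    have h₂ := base_comm (k fun _ => x) α
    rw [← Category.assoc, ← Category.assoc]
    refine (congrArg (· ≫ Limits.Sigma.map fun _ : ΩD.arity α => H) h₁.symm).trans ?_
    rw [Category.assoc]
    refine (congrArg (S.coalg.coop α ≫ ·) (map_comp_map_of_eq (hH _))).trans (h₂.trans ?_)
    exact congrArg (· ≫ R.coop α) (hH _).symm
  exact congrFun (congrArg OpAlg.Hom.toFun key) (c x)

end Coalg.ClosedSubset

/-- A cocomplete category has a terminal object if it has a weakly terminal object. -/
theorem hasTerminal_of_weaklyTerminal {K : Type v} [Category.{w} K] [HasColimitsOfSize.{w, w} K]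
    {T : K} (hT : ∀ X, Nonempty (X ⟶ T)) : HasTerminal K := by
  -- Dually to the wide equalizer used here, the terminal object is the joint coequalizer of all
  -- endomorphisms of `T`.
  have : HasInitial Kᵒᵖ := hasInitial_of_weakly_initial_and_hasWideEqualizers (T := Opposite.op T)
    fun X => (hT X.unop).map Quiver.Hom.op
  exact hasTerminal_of_hasInitial_op

/-- For a coalgebra `R'` of a smaller type, the category of `D`-coalgebras over `R'` has a terminal
object. -/
theorem hasTerminal_costructuredArrow_restrict (s : Set ΩD.Op)
    (R' : Coalg C.Alg (Variety.all (ΩD.restrict s))) :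
    HasTerminal (CostructuredArrow (Coalg.restrict (A := C.Alg) D s) R') := by
  let T := Term (closureSignature ΩC D) (Places ΩC)
  let P : ObjectProperty (CostructuredArrow (Coalg.restrict (A := C.Alg) D s) R') :=
    fun X => boundedCoalg C D T X.left
  have hP : ObjectProperty.EssentiallySmall.{u} P := by
    have : ObjectProperty.Small.{u} (⊤ : ObjectProperty (Discrete PUnit.{1})) :=
      small_of_injective (β := PUnit) (f := fun _ => PUnit.unit) fun _ _ _ => Subsingleton.elim _ _
    have h : ObjectProperty.EssentiallySmall.{u} (ObjectProperty.comma
        (Coalg.restrict (A := C.Alg) D s) (Functor.fromPUnit.{0} R') (boundedCoalg C D T) ⊤) :=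
      inferInstance
    exact ObjectProperty.EssentiallySmall.of_le (Q := ObjectProperty.comma
      (Coalg.restrict (A := C.Alg) D s) (Functor.fromPUnit.{0} R') (boundedCoalg C D T) ⊤)
      fun X hX => ⟨hX, trivial⟩
  have : HasColimitsOfShape P.FullSubcategory
      (CostructuredArrow (Coalg.restrict (A := C.Alg) D s) R') :=
    HasColimitsOfShape.of_essentiallySmall.{u, u} _ _
  -- The candidate is the colimit of all bounded objects over `R'`, not merely their coproduct: the
  -- compatibility of its coprojections is what gluing requires.
  refine hasTerminal_of_weaklyTerminal (T := colimit P.ι) fun Z => ?_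
  let X (g : Places ΩC → Z.left.obj.carrier) :
      CostructuredArrow (Coalg.restrict (A := C.Alg) D s) R' :=
    CostructuredArrow.mk
      ((Coalg.restrict D s).map (Coalg.ClosedSubset.generate g).coalgIncl ≫ Z.hom)
  let k (g) : X g ⟶ colimit P.ι := colimit.ι P.ι ⟨X g, boundedCoalg_generate g⟩
  obtain ⟨f, hf⟩ := Coalg.ClosedSubset.exists_glue (Q := Z.left) (fun g => (k g).left)
    fun {g g'} f hf => by
      let m : X g ⟶ X g' := CostructuredArrow.homMk f <| by
        change (Coalg.restrict D s).map f ≫ (Coalg.restrict D s).map _ ≫ Z.hom =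
          (Coalg.restrict D s).map _ ≫ Z.hom
        rw [← Category.assoc, ← Functor.map_comp, hf]
      exact congrArg CommaMorphism.left (colimit.w P.ι (P.homMk (X := ⟨X g, boundedCoalg_generate g⟩)
        (Y := ⟨X g', boundedCoalg_generate g'⟩) m))
  -- That `f` lies over `R'` is also checked on the subcoalgebra generated by each element.
  refine ⟨CostructuredArrow.homMk f (Coalg.hom_ext (Variety.hom_ext fun x => ?_))⟩
  let g : Places ΩC → Z.left.obj.carrier := fun _ => x
  have hx : (Coalg.restrict D s).map ((Coalg.ClosedSubset.generate g).coalgIncl ≫ f) ≫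
      (colimit P.ι).hom = (Coalg.restrict D s).map (Coalg.ClosedSubset.generate g).coalgIncl ≫
        Z.hom :=
    (congrArg (fun p => (Coalg.restrict D s).map p ≫ (colimit P.ι).hom) (hf g)).trans
      (CostructuredArrow.w (k g))
  rw [Functor.map_comp, Category.assoc] at hx
  let c : (Coalg.ClosedSubset.generate g).carrier :=
    ⟨x, Coalg.ClosedSubset.mem_generate g (Classical.arbitrary (Places ΩC))⟩
  exact congrFun (congrArg (fun p => OpAlg.Hom.toFun (Coalg.base p)) hx) c

end Cofree

/-! ### Coalgebras and representable functors; the adjunctions. -/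

section RepresentableFunctors

variable {Ω : Signature.{u}} {A : Type v} [Category.{u} A] {V : Variety Ω}

/-- The algebra-valued functor represented by a coalgebra. -/
noncomputable def Coalg.homFunctor [HasCoproducts.{u} A] (R : Coalg A V) : A ⥤ V.Alg where
  obj B := ⟨R.homAlg B, R.cosat B⟩
  map {B B'} g := OpAlg.Hom.mk (A := R.homAlg B) (B := R.homAlg B')
    (fun x : R.obj ⟶ B => x ≫ g) fun α a =>
      -- An operation is the value of the term `.op α fun j => .var j`, so naturality of term
      -- evaluation gives the homomorphism condition.
      R.evalHom_comp g (κ := Ω.arity α) a (.op α fun j => .var j)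
  map_id B := OpAlg.Hom.ext (funext fun x => Category.comp_id (X := R.obj) (Y := B) x)
  map_comp {B _ _} f g := OpAlg.Hom.ext (funext fun x =>
    (Category.assoc (W := R.obj) (X := B) x f g).symm)

/-- The functor represented by a coalgebra is represented by its underlying object. -/
noncomputable def Coalg.homFunctorCorepresentableBy [HasCoproducts.{u} A] (R : Coalg A V) :
    (R.homFunctor ⋙ V.forget).CorepresentableBy R.obj where
  homEquiv {B} := Equiv.refl (R.obj ⟶ B)
  homEquiv_comp _ _ := rfl

/-- A corepresentation of the underlying functor of an algebra-valued functor, in terms of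
elements of the algebras. -/
structure Corepresentation (H : A ⥤ V.Alg) (Q : A) where
  equiv : ∀ B, (Q ⟶ B) ≃ (H.obj B).carrier
  equiv_comp : ∀ {B B' : A} (f : Q ⟶ B) (g : B ⟶ B'),
    equiv B' (f ≫ g) = OpAlg.Hom.toFun (H.map g) (equiv B f)

/-- The corepresentation in terms of elements. -/
def Corepresentation.ofCorepresentableBy {H : A ⥤ V.Alg} {Q : A}
    (c : (H ⋙ V.forget).CorepresentableBy Q) : Corepresentation H Q where
  equiv _ := c.homEquiv
  equiv_comp f g := c.homEquiv_comp g f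

namespace Corepresentation

variable [HasCoproducts.{u} A] {H : A ⥤ V.Alg} {Q : A} (c : Corepresentation H Q)

/-- The coalgebra structure on a representing object of an algebra-valued functor. -/
noncomputable def opCoalg : OpCoalg Ω A where
  obj := Q
  coop α := (c.equiv _).symm
    ((H.obj _).op α fun j => c.equiv _ (Limits.Sigma.ι (fun _ : Ω.arity α => Q) j))

/-- The co-operation represents the operation applied to the generic tuple of coprojections;
naturality along `Sigma.desc a` carries this to the tuple `a`. -/
theorem equiv_coop_desc (α : Ω.Op) {B : A} (a : Ω.arity α → (Q ⟶ B)) :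
    c.equiv B (c.opCoalg.coop α ≫ Limits.Sigma.desc a) =
      (H.obj B).op α fun j => c.equiv B (a j) := by
  refine (c.equiv_comp _ _).trans ?_
  refine (congrArg (OpAlg.Hom.toFun (H.map (Limits.Sigma.desc a)))
    ((c.equiv _).apply_symm_apply _)).trans ((OpAlg.Hom.map_op _ _ _).trans ?_)
  refine congrArg _ (funext fun j => ?_)
  rw [← c.equiv_comp, Limits.Sigma.ι_desc]

/-- The given algebras are those induced by the coalgebra. -/
def homAlgHom (B : A) : OpAlg.Hom (c.opCoalg.homAlg B) (H.obj B).toOpAlg :=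
  ⟨c.equiv B, fun α => c.equiv_coop_desc α⟩

/-- The `V`-coalgebra structure on a representing object of a `V`-valued functor. -/
noncomputable def coalg : Coalg A V where
  toOpCoalg := c.opCoalg
  cosat B := (H.obj B).models.of_injective (c.homAlgHom B) (c.equiv B).injective

variable {R : Coalg A V}

/-- The value of a natural transformation at a morphism from the representing object. -/
def eval (φ : R.homFunctor ⟶ H) {B : A} (x : R.obj ⟶ B) : (H.obj B).carrier :=
  OpAlg.Hom.toFun (φ.app B) x

theorem eval_comp (φ : R.homFunctor ⟶ H) {B B' : A} (x : R.obj ⟶ B) (g : B ⟶ B') :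
    eval φ (x ≫ g) = OpAlg.Hom.toFun (H.map g) (eval φ x) :=
  congrFun (congrArg OpAlg.Hom.toFun (φ.naturality g)) x

theorem eval_coop_desc (φ : R.homFunctor ⟶ H) (α : Ω.Op) {B : A}
    (a : Ω.arity α → (R.obj ⟶ B)) :
    eval φ (R.coop α ≫ Limits.Sigma.desc a) = (H.obj B).op α fun j => eval φ (a j) :=
  OpAlg.Hom.map_op (φ.app B) α a

/-- The morphism of representing objects that corresponds to a natural transformation. -/
def yoneda (φ : R.homFunctor ⟶ H) : Q ⟶ R.obj := (c.equiv _).symm (eval φ (𝟙 R.obj))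

theorem equiv_yoneda_comp (φ : R.homFunctor ⟶ H) {B : A} (x : R.obj ⟶ B) :
    c.equiv B (c.yoneda φ ≫ x) = eval φ x := by
  rw [c.equiv_comp, yoneda, Equiv.apply_symm_apply, ← eval_comp, Category.id_comp]

/-- The morphism of coalgebras that corresponds to a natural transformation. -/
def yonedaHom (φ : R.homFunctor ⟶ H) : c.coalg ⟶ R :=
  OpCoalg.Hom.mk (R := c.opCoalg) (c.yoneda φ) fun α => (c.equiv _).injective <| by
    have h₁ := c.equiv_coop_desc α fun j =>
      c.yoneda φ ≫ Limits.Sigma.ι (fun _ : Ω.arity α => R.obj) j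
    have h₂ := eval_coop_desc φ α (Limits.Sigma.ι fun _ : Ω.arity α => R.obj)
    have e₁ : Limits.Sigma.map (fun _ : Ω.arity α => c.yoneda φ) = Limits.Sigma.desc fun j =>
        c.yoneda φ ≫ Limits.Sigma.ι (fun _ : Ω.arity α => R.obj) j :=
      Limits.Sigma.hom_ext _ _ fun j => by simp
    have e₂ : Limits.Sigma.desc (Limits.Sigma.ι fun _ : Ω.arity α => R.obj) = 𝟙 _ :=
      Limits.Sigma.hom_ext _ _ fun j => by simp
    rw [e₂, Category.comp_id] at h₂
    refine (congrArg (fun p => c.equiv _ (c.opCoalg.coop α ≫ p)) e₁).trans (h₁.trans ?_)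
    refine Eq.trans ?_ (h₂.symm.trans (c.equiv_yoneda_comp φ _).symm)
    exact congrArg _ (funext fun j => c.equiv_yoneda_comp φ _)

/-- The natural transformation that corresponds to a morphism of coalgebras. -/
noncomputable def ofHom (h : c.coalg ⟶ R) : R.homFunctor ⟶ H where
  app B := OpAlg.Hom.mk (A := R.homAlg B) (fun x : R.obj ⟶ B => c.equiv B (Coalg.base h ≫ x))
    fun α a => by
      have e := OpCoalg.Hom.comp_evalHom h (κ := Ω.arity α) a (.op α fun j => .var j)
      exact (congrArg (c.equiv B) e).trans (c.equiv_coop_desc α _)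
  naturality B B' g := Variety.hom_ext fun x =>
    (congrArg (c.equiv B') (Category.assoc (Coalg.base h) (x : R.obj ⟶ B) g).symm).trans
      (c.equiv_comp _ _)

theorem natTrans_ext {φ ψ : R.homFunctor ⟶ H} (h : ∀ {B} (x : R.obj ⟶ B), eval φ x = eval ψ x) :
    φ = ψ :=
  NatTrans.ext (funext fun _ => Variety.hom_ext h)

end Corepresentation

variable [HasCoproducts.{u} A]

variable (V) in
/-- If there are universal `V`-coalgebras over all objects, then the functor from representable
`V`-valued functors to representable set-valued functors has a left adjoint. -/
theorem Rep.isRightAdjoint_compForget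
    (hA : ∀ X : A, ∃ (R : Coalg A V) (f : R.obj ⟶ X),
      ∀ (Q : Coalg A V) (g : Q.obj ⟶ X), ∃! h : Q ⟶ R, Coalg.base h ≫ f = g) :
    (Rep.compForget A V).IsRightAdjoint := by
  have (F : RepSet A) : HasInitial (StructuredArrow F (Rep.compForget A V)) := by
    obtain ⟨X, ⟨e⟩⟩ := F.property.has_corepresentation
    obtain ⟨R, f, hR⟩ := hA X
    -- Corepresentation is contravariant: a universal coalgebra over the object representing `F`
    -- gives an initial arrow out of `F`.
    let G : Rep A V := ⟨R.homFunctor, R.homFunctorCorepresentableBy.isCorepresentable⟩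
    let η₀ : F.obj ⟶ R.homFunctor ⋙ V.forget :=
      { app := fun B => ↾fun x => (f ≫ e.homEquiv.symm x : R.obj ⟶ B)
        naturality := fun B B' g => by
          ext x
          refine (congrArg (f ≫ ·) (e.homEquiv_symm_comp x g).symm).trans ?_
          exact (Category.assoc f (e.homEquiv.symm x) g).symm }
    let η : F ⟶ (Rep.compForget A V).obj G := ObjectProperty.homMk η₀
    have main (Y : StructuredArrow F (Rep.compForget A V)) :
        Nonempty (Unique (StructuredArrow.mk η ⟶ Y)) := by
      obtain ⟨Q, ⟨c'⟩⟩ := Y.right.property.has_corepresentation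
      let c := Corepresentation.ofCorepresentableBy c'
      let θ (B : A) (x : F.obj.obj B) : (Y.right.obj.obj B).carrier := Y.hom.hom.app B x
      have hθ {B B' : A} (x : F.obj.obj B) (g : B ⟶ B') :
          θ B' (F.obj.map g x) = OpAlg.Hom.toFun (Y.right.obj.map g) (θ B x) :=
        ConcreteCategory.congr_hom (Y.hom.hom.naturality g) x
      -- The Yoneda counterpart of `Y.hom`.
      let g : Q ⟶ X := (c.equiv X).symm (θ X (e.homEquiv (𝟙 X)))
      have hg {B : A} (x : F.obj.obj B) : c.equiv B (g ≫ e.homEquiv.symm x) = θ B x := by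
        rw [c.equiv_comp, Equiv.apply_symm_apply, ← hθ, ← e.homEquiv_comp, Category.id_comp,
          Equiv.apply_symm_apply]
      obtain ⟨h, hh, hu⟩ := hR c.coalg g
      have w (φ : StructuredArrow.mk η ⟶ Y) {B : A} (x : F.obj.obj B) :
          Corepresentation.eval φ.right.hom (f ≫ e.homEquiv.symm x) = θ B x :=
        ConcreteCategory.congr_hom
          (congrArg (fun p => NatTrans.app (InducedCategory.Hom.hom p) B)
            (StructuredArrow.w φ)) x
      refine ⟨⟨⟨StructuredArrow.homMk (ObjectProperty.homMk (c.ofHom h)) ?_⟩, fun φ => ?_⟩⟩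
      · refine ObjectProperty.hom_ext _ (NatTrans.ext (funext fun B => ?_))
        ext x
        have e₁ : Coalg.base h ≫ f ≫ e.homEquiv.symm x = g ≫ e.homEquiv.symm x :=
          (Category.assoc _ _ _).symm.trans (congrArg (· ≫ e.homEquiv.symm x) hh)
        exact (congrArg (c.equiv B) e₁).trans (hg x)
      -- The triangle for `φ`, evaluated at the identity of `X`, says that the corresponding
      -- coalgebra morphism lies over `g`; so it is `h`.
      · have key : c.yonedaHom φ.right.hom = h := hu _ <| (c.equiv X).injective <| by
          refine (c.equiv_yoneda_comp φ.right.hom f).trans ?_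
          have := w φ (e.homEquiv (𝟙 X))
          rw [Equiv.symm_apply_apply, Category.comp_id] at this
          exact this.trans ((c.equiv X).apply_symm_apply _).symm
        refine StructuredArrow.hom_ext _ _ (ObjectProperty.hom_ext _
          (Corepresentation.natTrans_ext fun {B} x => ?_))
        refine (c.equiv_yoneda_comp φ.right.hom x).symm.trans ?_
        exact congrArg (fun p => c.equiv B (Coalg.base p ≫ x)) key
    have (Y : StructuredArrow F (Rep.compForget A V)) : Unique (StructuredArrow.mk η ⟶ Y) :=
      (main Y).some
    exact hasInitial_of_unique (StructuredArrow.mk η)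
  exact isRightAdjointOfStructuredArrowInitials _

variable (V) in
/-- If there are universal `V`-coalgebras over all objects, then the forgetful functor from
`V`-coalgebras has a right adjoint. -/
theorem Coalg.isLeftAdjoint_forget
    (hA : ∀ X : A, ∃ (R : Coalg A V) (f : R.obj ⟶ X),
      ∀ (Q : Coalg A V) (g : Q.obj ⟶ X), ∃! h : Q ⟶ R, Coalg.base h ≫ f = g) :
    (Coalg.forget A V).IsLeftAdjoint := by
  have (X : A) : HasTerminal (CostructuredArrow (Coalg.forget A V) X) := by
    obtain ⟨R, f, hR⟩ := hA X
    have (Y : CostructuredArrow (Coalg.forget A V) X) :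
        Unique (Y ⟶ CostructuredArrow.mk (S := Coalg.forget A V) (Y := R) f) :=
      { default := CostructuredArrow.homMk (hR Y.left Y.hom).choose (hR Y.left Y.hom).choose_spec.1
        uniq := fun φ => CostructuredArrow.hom_ext _ _
          ((hR Y.left Y.hom).choose_spec.2 _ (CostructuredArrow.w φ)) }
    exact hasTerminal_of_unique (CostructuredArrow.mk (S := Coalg.forget A V) (Y := R) f)
  exact isLeftAdjoint_of_costructuredArrowTerminals _

end RepresentableFunctors

/-- For a coalgebra `R'` of a smaller type, there is a universal `D`-coalgebra over `R'`. -/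
theorem exists_universal_coalg {ΩC ΩD : Signature.{u}} {C : Variety ΩC} (D : Variety ΩD)
    (s : Set ΩD.Op) (R' : OpCoalg (ΩD.restrict s) C.Alg) :
    ∃ (R : Coalg C.Alg D) (f : OpCoalg.Hom (R.toOpCoalg.restrict s) R'),
      ∀ (Q : Coalg C.Alg D) (g : OpCoalg.Hom (Q.toOpCoalg.restrict s) R'),
        ∃! h : Q ⟶ R, Coalg.base h ≫ f.hom = g.hom := by
  have := hasTerminal_costructuredArrow_restrict (C := C) (D := D) s R'.toCoalg
  let X := ⊤_ (CostructuredArrow (Coalg.restrict (A := C.Alg) D s) R'.toCoalg)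
  refine ⟨X.left, X.hom, fun Q g => ?_⟩
  obtain ⟨h, hh, hu⟩ := CostructuredArrow.IsUniversal.existsUnique
    (f := X) terminalIsTerminal (CostructuredArrow.mk (S := Coalg.restrict (A := C.Alg) D s)
      (Y := Q) (T := R'.toCoalg) g)
  exact ⟨h, congrArg Coalg.base hh, fun h' hh' => hu h' (Coalg.hom_ext hh')⟩

end GenAlg

open GenAlg

theorem theoremT {ΩC ΩD : Signature.{u}} (C : Variety ΩC) (D : Variety ΩD) :
    -- a universal `D`-coalgebra with a homomorphism to a given algebra
    (∀ A : C.Alg, ∃ (R : Coalg C.Alg D) (f : R.obj ⟶ A),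
      ∀ (Q : Coalg C.Alg D) (g : Q.obj ⟶ A), ∃! h : Q ⟶ R, Coalg.base h ≫ f = g) ∧
    -- the forgetful functor from coalgebras to algebras has a right adjoint
    (Coalg.forget C.Alg D).IsLeftAdjoint ∧
    -- composition with the underlying set functor of `D` has a left adjoint
    (Rep.compForget C.Alg D).IsRightAdjoint ∧
    -- a universal `D`-coalgebra over a given `D'`-coalgebra, for `D'` of a subtype
    (∀ (s : Set ΩD.Op) (D' : Variety (ΩD.restrict s)) (R' : Coalg C.Alg D'),
      ∃ (R : Coalg C.Alg D) (f : R.obj ⟶ R'.obj), Coalg.Respects R R' f ∧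
        ∀ (Q : Coalg C.Alg D) (g : Q.obj ⟶ R'.obj), Coalg.Respects Q R' g →
          ∃! h : Q ⟶ R, Coalg.base h ≫ f = g) := by
  have universal (A : C.Alg) : ∃ (R : Coalg C.Alg D) (f : R.obj ⟶ A),
      ∀ (Q : Coalg C.Alg D) (g : Q.obj ⟶ A), ∃! h : Q ⟶ R, Coalg.base h ≫ f = g := by
    -- With no co-operations prescribed, a coalgebra structure on `A` is no data and every
    -- homomorphism respects it.
    obtain ⟨R, f, h⟩ := exists_universal_coalg D ∅ ⟨A, fun α => α.2.elim⟩
    exact ⟨R, f.hom, fun Q g => h Q ⟨g, fun α => α.2.elim⟩⟩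
  refine ⟨universal, Coalg.isLeftAdjoint_forget D universal,
    Rep.isRightAdjoint_compForget D universal, fun s D' R' => ?_⟩
  -- Only the co-operations of `R'` enter; the identities of `D'` are discarded.
  obtain ⟨R, f, h⟩ := exists_universal_coalg D s R'.toOpCoalg
  exact ⟨R, f.hom, f.comm, fun Q g hg => h Q ⟨g, hg⟩⟩
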